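/- Let $\mathbf V=\bigcup_{n\ge 0}\mathbb N^n$ be the infinite Ulam–Harris tree with root $\varnothing$, where $|v|=n$ for $v\in\mathbb N^n$. On a probability space let $L_i(v)\ge 0$ ($v\in\mathbf V$, $i\in\mathbb N$) be random variables such that the sequences $(L_i(v))_{i\in\mathbb N}$, $v\in\mathbf V$, are independent and identically distributed (with arbitrary dependence within each sequence). Put $L_\varnothing:=1$, $L_{vi}:=L_i(v)L_v$, and $$Z_n:=\sum_{|v|=n}L_v,\qquad m(r):=\mathbb E\sum_{|v|=1}L_v^r\quad(r>0),\qquad W_n:=\frac{Z_n}{m(1)^n}.$$ Assume that $\mathbb E\,\#\{v:|v|=1,\ L_v>0\}>1$ (supercriticality) and $m(1)=1$. Let $p>1$ and $\mathbb E W_1^p<\infty$. Then $\mathbb E W_n^p<\infty$ for all $n$, whenever $m(p)\ge 1$, and, as $n\to\infty$, the following hold. (a) If $p\in(1,2]$, then $\mathbb E W_n^p=O(n)$ if $m(p)=1$, and $\mathbb E W_n^p=O(m(p)^n)$ if $m(p)>1$. (b) If $p>2$, then $\mathbb E W_n^p=O(n^{p-1})$ if $m(p)=1$, and, if $m(p)>1$,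 $\mathbb E W_n^p=O(n^{b(p-1)}m(p)^n)$ for $p\in(b+1,b+2]$, $b\in\{1,2,\dots\}$. -/

import Mathlib

open MeasureTheory ProbabilityTheory Filter Asymptotics
open scoped NNReal ENNReal

namespace WBP


/-- The individuals are the vertices of the infinite Ulam-Harris tree `⋃ₙ ℕⁿ`: a finite word
`v₁ ⋯ vₙ` is the list `[v₁, …, vₙ]`, the root is `[]`, and the children of `v` are `v ++ [i]`.
A family `L : List ℕ → ℕ → Ω → ℝ≥0` attaches the nonnegative random weight `Lᵢ(v) = L v i` to the
edge from `v` to `v ++ [i]`. It is a weighted branching process if the random sequences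
`(Lᵢ(v))ᵢ`, `v` an individual, are independent and identically distributed. Within one sequence
the dependence is arbitrary. -/
structure IsWeightedBranchingProcess {Ω : Type*} [MeasurableSpace Ω] (P : Measure Ω) (L : List ℕ → ℕ → Ω → ℝ≥0) : Prop where
  measurable : ∀ v i, Measurable (L v i)
  indep : iIndepFun (fun (v : List ℕ) (ω : Ω) (i : ℕ) => L v i ω) P
  identDistrib : ∀ v : List ℕ,
    IdentDistrib (fun (ω : Ω) (i : ℕ) => L v i ω) (fun (ω : Ω) (i : ℕ) => L [] i ω) P P

/-- The total weight `L_w(u)` of the path from `u` to `u ++ w`, that is, the product of the weights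
of the edges along this path. -/
def pathWeight {Ω : Type*} (L : List ℕ → ℕ → Ω → ℝ≥0) : List ℕ → List ℕ → Ω → ℝ≥0
  | _, [], _ => 1
  | u, i :: w, ω => L u i ω * pathWeight L (u ++ [i]) w ω

/-- The recursion `L_{wi}(u) = Lᵢ(uw) L_w(u)`. -/
theorem pathWeight_append_singleton {Ω : Type*} (L : List ℕ → ℕ → Ω → ℝ≥0) (u w : List ℕ) (i : ℕ) (ω : Ω) :
    pathWeight L u (w ++ [i]) ω = L (u ++ w) i ω * pathWeight L u w ω := by
  induction w generalizing u with
  | nil => simp [pathWeight]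
  | cons j w ih =>
    simp only [List.cons_append, pathWeight, ih, List.append_assoc, List.nil_append]
    ring

/-- The weight `L_v` of the individual `v`: the total weight of the path from the root to `v`. -/
def weight {Ω : Type*} (L : List ℕ → ℕ → Ω → ℝ≥0) (v : List ℕ) (ω : Ω) : ℝ≥0 :=
  pathWeight L [] v ω

/-- `Zₙ`, the sum of `L_v` over all individuals `v` of generation `n`. -/
noncomputable def Z {Ω : Type*} (L : List ℕ → ℕ → Ω → ℝ≥0) (n : ℕ) (ω : Ω) : ℝ≥0∞ :=
  ∑' v : List.Vector ℕ n, (weight L v.toList ω : ℝ≥0∞)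

/-- The number `J` of children of the root, that is, of first-generation individuals of positive
weight. -/
noncomputable def J {Ω : Type*} (L : List ℕ → ℕ → Ω → ℝ≥0) (ω : Ω) : ℝ≥0∞ :=
  ∑' v : List.Vector ℕ 1, if 0 < weight L v.toList ω then 1 else 0

/-- `m(r)`, for `r > 0`: the expected sum of `L_v ^ r` over the first generation. -/
noncomputable def m {Ω : Type*} [MeasurableSpace Ω] (P : Measure Ω) (L : List ℕ → ℕ → Ω → ℝ≥0) (r : ℝ) : ℝ≥0∞ :=
  ∫⁻ ω, ∑' v : List.Vector ℕ 1, (weight L v.toList ω : ℝ≥0∞) ^ r ∂P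

/-- `Wₙ = Zₙ / m(1)ⁿ`. -/
noncomputable def W {Ω : Type*} [MeasurableSpace Ω] (P : Measure Ω) (L : List ℕ → ℕ → Ω → ℝ≥0) (n : ℕ) (ω : Ω) : ℝ≥0∞ :=
  Z L n ω / m P L 1 ^ n

/-- The moment `𝔼 Wₙᵖ`, possibly infinite. -/
noncomputable def momentW {Ω : Type*} [MeasurableSpace Ω] (P : Measure Ω) (L : List ℕ → ℕ → Ω → ℝ≥0) (p : ℝ) (n : ℕ) : ℝ≥0∞ :=
  ∫⁻ ω, W P L n ω ^ p ∂P

/-- `a n = O(g n)` as `n → ∞`, for a sequence of extended nonnegative numbers: all `a n` are finite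
and, as real numbers, they are `O(g n)`. -/
def IsFiniteBigO (a : ℕ → ℝ≥0∞) (g : ℕ → ℝ) : Prop :=
  (∀ n, a n < ∞) ∧ (fun n => (a n).toReal) =O[atTop] g

end WBP

/-!
Write `q = p - 1` and `w n = 𝔼 Wₙᵖ`. As `m(1) = 1`, `Wₙ = Zₙ`, and decomposing at the first
generation gives `Zₙ₊₁ = ∑ᵢ Tᵢ Xᵢ`, where `Tᵢ` is the weight of the `i`-th child of the root and
`Xᵢ` is the total weight of the `n`-th generation of its subtree. The `Xᵢ` are independent copies
of `Zₙ`, of mean one, and independent of `(Tᵢ)`.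

With `S = ∑ᵢ Tᵢ Xᵢ`, `yᵢ = Tᵢ Xᵢ` and `Sᵢ = S - yᵢ`, expand `S ^ p = ∑ᵢ yᵢ (yᵢ + Sᵢ) ^ q`.
If `q ≤ 1`, then `(yᵢ + Sᵢ) ^ q ≤ yᵢ ^ q + Sᵢ ^ q`; if `q ≥ 1`, then
`(yᵢ + Sᵢ) ^ q ≤ yᵢ ^ q + c (yᵢ ^ (q - 1) Sᵢ + Sᵢ ^ q)` (`add_rpow_le_rpow_add_mul`). In both cases
the leading terms contribute exactly `𝔼 ∑ᵢ yᵢ ^ p = m(p) w n`. In the others `Xᵢ` is independent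
of `Tᵢ` and `Sᵢ`, so it can be integrated out, and what remains is bounded by a multiple of
`𝔼 Z₁ᵖ`, times `𝔼 Zₙ^q` if `q ≥ 1`. By Lyapunov's inequality and `𝔼 Zₙ = 1`,
`𝔼 Zₙ^q ≤ w n ^ (1 - 1 / q)`. With `β = max 1 (p - 1)` this is the recursion

  `w (n + 1) ≤ m(p) w n + C w n ^ (1 - 1 / β)`

(`IsWeightedBranchingProcess.momentW_recursion`). Essentially, `w n ^ (1 / β)` satisfies the
affine recursion `x (n + 1) = m(p) ^ (1 / β) x n + C` as an inequality (`le_rpow_of_recursion`), so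
`w n = O(n ^ β)` if `m(p) = 1`, and `w n = O(m(p) ^ n)` if `m(p) > 1`. For `p > 2` the latter is
stronger than the bound with a polynomial factor.
-/

namespace WBP

/-! ### Elementary inequalities in `ℝ≥0∞` -/

/-- The leading term `y ^ q` carries the constant `1`; this is what makes the moments grow with the
exact rate `m(p)`. -/
theorem add_rpow_le_rpow_add_mul {q : ℝ} (hq : 1 ≤ q) (y s : ℝ≥0∞) :
    (y + s) ^ q ≤ y ^ q + ENNReal.ofReal (q * 2 ^ (q - 1)) * (y ^ (q - 1) * s + s ^ q) := by
  have hq0 : 0 < q := by linarith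
  have hc : 0 < q * (2 : ℝ) ^ (q - 1) := by positivity
  rcases eq_or_ne y ∞ with rfl | hy
  · simp [ENNReal.top_rpow_of_pos hq0]
  rcases eq_or_ne s ∞ with rfl | hs
  · simp [ENNReal.top_rpow_of_pos hq0, ENNReal.mul_top, hc]
  lift y to ℝ≥0 using hy
  lift s to ℝ≥0 using hs
  rw [ENNReal.ofReal]
  simp only [← ENNReal.coe_rpow_of_nonneg _ hq0.le, ← ENNReal.coe_add, ← ENNReal.coe_mul,
    ← ENNReal.coe_rpow_of_nonneg _ (sub_nonneg.2 hq)]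
  rw [ENNReal.coe_le_coe, ← NNReal.coe_le_coe]
  push_cast
  rw [Real.coe_toNNReal _ hc.le]
  have hy : (0 : ℝ) ≤ y := y.2
  have hs : (0 : ℝ) ≤ s := s.2
  generalize (y : ℝ) = y at *
  generalize (s : ℝ) = s at *
  have split (x : ℝ) (hx : 0 ≤ x) : x ^ q = x ^ (q - 1) * x := by
    conv_rhs => rw [← Real.rpow_one x]
    rw [Real.rpow_one, ← Real.rpow_add_one' hx (by linarith)]
    ring_nf
  -- The tangent to `x ↦ x ^ q` at `y + s` lies below the graph, so that
  -- `(y+s)^q - y^q ≤ q s (y+s)^(q-1)`.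
  have tangent : (y + s) ^ q ≤ y ^ q + q * s * (y + s) ^ (q - 1) := by
    rcases (add_nonneg hy hs).eq_or_lt with h0 | h0
    · rw [← h0, Real.zero_rpow hq0.ne']; positivity
    have hb := one_add_mul_self_le_rpow_one_add (s := y / (y + s) - 1)
      (by have : 0 ≤ y / (y + s) := by positivity
          linarith) hq
    rw [add_sub_cancel, Real.div_rpow hy h0.le, le_div_iff₀ (by positivity)] at hb
    have : (1 + q * (y / (y + s) - 1)) * (y + s) ^ q
        = (y + s) ^ q - q * s * (y + s) ^ (q - 1) := by
      rw [split _ h0.le]; field_simp; ring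
    linarith
  have hmax : (y + s) ^ (q - 1) * s ≤ 2 ^ (q - 1) * (y ^ (q - 1) * s + s ^ q) := by
    rw [split s hs, ← add_mul, ← mul_assoc]
    refine mul_le_mul_of_nonneg_right ?_ hs
    have key (x : ℝ) (hx : 0 ≤ x) (h : y + s ≤ 2 * x) :
        (y + s) ^ (q - 1) ≤ 2 ^ (q - 1) * x ^ (q - 1) := by
      rw [← Real.mul_rpow (by norm_num) hx]
      exact Real.rpow_le_rpow (by positivity) h (by linarith)
    have h1 : 0 ≤ y ^ (q - 1) := by positivity
    have h2 : 0 ≤ s ^ (q - 1) := by positivity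
    rcases le_total y s with h | h
    · exact (key s hs (by linarith)).trans (by gcongr; linarith)
    · exact (key y hy (by linarith)).trans (by gcongr; linarith)
  nlinarith [mul_le_mul_of_nonneg_left hmax hq0.le]

/-- Linearization of `s ↦ s ^ q` at the scale `a`, for `q ≤ 1`. -/
theorem mul_rpow_le_rpow_mul_add {q : ℝ} (hq0 : 0 ≤ q) (hq1 : q ≤ 1) (a s : ℝ≥0∞) :
    a * s ^ q ≤ a ^ q * (s + a) := by
  rcases le_total s a with h | h
  · calc a * s ^ q ≤ a * a ^ q := by gcongr
      _ ≤ a ^ q * (s + a) := by rw [mul_comm]; gcongr; exact le_add_self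
  · calc a * s ^ q = a ^ q * (a ^ (1 - q) * s ^ q) := by
          rw [← mul_assoc, ← ENNReal.rpow_add_of_nonneg _ _ hq0 (by linarith)]; simp
      _ ≤ a ^ q * (s ^ (1 - q) * s ^ q) := by
          gcongr
      _ = a ^ q * s := by
          rw [← ENNReal.rpow_add_of_nonneg _ _ (by linarith) hq0]; simp
      _ ≤ a ^ q * (s + a) := by gcongr; exact le_self_add

/-- Jensen's inequality for the weights `t i`, which need not sum to one. -/
theorem tsum_mul_rpow_le {r : ℝ} (hr : 1 ≤ r) (t x : ℕ → ℝ≥0∞) :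
    (∑' i, t i * x i) ^ r ≤ (∑' i, t i) ^ (r - 1) * ∑' i, t i * x i ^ r := by
  have hr0 : 0 < r := by linarith
  have hr1 : 1 / r ≤ 1 := by rw [div_le_one hr0]; exact hr
  have h := ENNReal.lintegral_mul_norm_pow_le (μ := Measure.count)
    (f := fun i : ℕ => t i * x i ^ r) (g := t) (measurable_of_countable _).aemeasurable
    (measurable_of_countable _).aemeasurable (p := 1 / r) (q := 1 - 1 / r) (by positivity)
    (by linarith) (by ring)
  simp only [lintegral_count] at h
  have e (i : ℕ) : (t i * x i ^ r) ^ (1 / r) * t i ^ (1 - 1 / r) = t i * x i := by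
    rw [ENNReal.mul_rpow_of_nonneg _ _ (by positivity), ← ENNReal.rpow_mul,
      mul_one_div_cancel hr0.ne', ENNReal.rpow_one, mul_right_comm,
      ← ENNReal.rpow_add_of_nonneg _ _ (by positivity) (by linarith)]
    simp
  simp only [e] at h
  refine (ENNReal.rpow_le_rpow h hr0.le).trans_eq ?_
  rw [ENNReal.mul_rpow_of_nonneg _ _ hr0.le, ← ENNReal.rpow_mul, ← ENNReal.rpow_mul,
    one_div_mul_cancel hr0.ne', ENNReal.rpow_one, mul_comm, sub_mul, one_div_mul_cancel hr0.ne',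
    one_mul]

theorem mul_rpow_sub_one {r : ℝ} (hr : 1 ≤ r) (x : ℝ≥0∞) : x * x ^ (r - 1) = x ^ r := by
  conv_lhs => rw [← ENNReal.rpow_one x, ← ENNReal.rpow_mul, one_mul]
  rw [← ENNReal.rpow_add_of_nonneg _ _ zero_le_one (by linarith)]; simp

theorem tsum_rpow_le_rpow_tsum {r : ℝ} (hr : 1 ≤ r) (t : ℕ → ℝ≥0∞) :
    ∑' i, t i ^ r ≤ (∑' i, t i) ^ r := by
  simp only [← mul_rpow_sub_one hr]
  rw [← ENNReal.tsum_mul_right]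
  refine ENNReal.tsum_le_tsum fun i => ?_
  exact mul_le_mul_right (ENNReal.rpow_le_rpow (ENNReal.le_tsum i) (by linarith)) _

/-- Lyapunov's inequality, between the exponents `1` and `r + 1`. -/
theorem lintegral_rpow_le_of_lintegral_eq_one {Ω : Type*} [MeasurableSpace Ω] {P : Measure Ω}
    {Y : Ω → ℝ≥0∞} (hY : Measurable Y) (h1 : ∫⁻ ω, Y ω ∂P = 1) {r : ℝ} (hr : 1 ≤ r) :
    ∫⁻ ω, Y ω ^ r ∂P ≤ (∫⁻ ω, Y ω ^ (r + 1) ∂P) ^ (1 - 1 / r) := by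
  have hr0 : 0 < r := by linarith
  have hr1 : 1 / r ≤ 1 := by rw [div_le_one hr0]; exact hr
  have h := ENNReal.lintegral_mul_norm_pow_le (μ := P) (f := fun ω => Y ω ^ (r + 1)) (g := Y)
    (hY.pow_const _).aemeasurable hY.aemeasurable (p := 1 - 1 / r) (q := 1 / r)
    (by linarith) (by positivity) (by ring)
  rw [h1, ENNReal.one_rpow, mul_one] at h
  refine le_of_eq_of_le (lintegral_congr fun ω => ?_) h
  rw [← ENNReal.rpow_mul, ← ENNReal.rpow_add_of_nonneg _ _
    (mul_nonneg (by linarith) (by linarith)) (by positivity)]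
  congr 1
  field_simp
  ring

/-! ### Moments of a randomly weighted sum -/

section WeightedSum

variable {Ω : Type*} [MeasurableSpace Ω] {P : Measure Ω} {T X : ℕ → Ω → ℝ≥0∞} {Y : Ω → ℝ≥0∞}

theorem measurable_ite_eq_zero (hX : ∀ i, Measurable (X i)) (i j : ℕ) :
    Measurable fun ω => if j = i then 0 else X j ω := by
  by_cases h : j = i
  · simp [h]
  · simpa [h] using hX j

theorem lintegral_rpow_eq_of_identDistrib (hXY : ∀ i, IdentDistrib (X i) Y P P) (r : ℝ) (i : ℕ) :
    ∫⁻ ω, X i ω ^ r ∂P = ∫⁻ ω, Y ω ^ r ∂P :=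
  ((hXY i).comp (measurable_id.pow_const r)).lintegral_eq

/-- The independence assumption of this section: `X i` is independent of all weights `T j` jointly
with all `X j`, `j ≠ i`. Replacing `X i` by `0` keeps the second component a sequence indexed
by `ℕ`. -/
theorem lintegral_rpow_mul_of_indepFun (hT : ∀ i, Measurable (T i)) (hX : ∀ i, Measurable (X i))
    {i : ℕ}
    (hind : IndepFun (X i) (fun ω => (fun j => T j ω, fun j => if j = i then 0 else X j ω)) P)
    {φ : (ℕ → ℝ≥0∞) × (ℕ → ℝ≥0∞) → ℝ≥0∞} (hφ : Measurable φ) (r : ℝ) :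
    ∫⁻ ω, X i ω ^ r * φ (fun j => T j ω, fun j => if j = i then 0 else X j ω) ∂P
      = (∫⁻ ω, X i ω ^ r ∂P)
        * ∫⁻ ω, φ (fun j => T j ω, fun j => if j = i then 0 else X j ω) ∂P := by
  have hm : Measurable fun ω => (fun j => T j ω, fun j => if j = i then 0 else X j ω) :=
    (measurable_pi_lambda _ hT).prodMk (measurable_pi_lambda _ (measurable_ite_eq_zero hX i))
  exact lintegral_mul_eq_lintegral_mul_lintegral_of_indepFun ((hX i).pow_const r)
    (hφ.comp hm) (hind.comp (measurable_id.pow_const r) hφ)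

theorem lintegral_rpow_mul_weight (hT : ∀ i, Measurable (T i)) (hX : ∀ i, Measurable (X i))
    (hind : ∀ i, IndepFun (X i)
      (fun ω => (fun j => T j ω, fun j => if j = i then 0 else X j ω)) P)
    (hXY : ∀ i, IdentDistrib (X i) Y P P) {φ : (ℕ → ℝ≥0∞) → ℝ≥0∞} (hφ : Measurable φ)
    (r : ℝ) (i : ℕ) :
    ∫⁻ ω, X i ω ^ r * φ (fun j => T j ω) ∂P
      = (∫⁻ ω, Y ω ^ r ∂P) * ∫⁻ ω, φ (fun j => T j ω) ∂P := by
  rw [← lintegral_rpow_eq_of_identDistrib hXY r i]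
  exact lintegral_rpow_mul_of_indepFun hT hX (hind i) (φ := fun z => φ z.1)
    (hφ.comp measurable_fst) r

theorem lintegral_rpow_mul_weightedSum (hT : ∀ i, Measurable (T i)) (hX : ∀ i, Measurable (X i))
    (hind : ∀ i, IndepFun (X i)
      (fun ω => (fun j => T j ω, fun j => if j = i then 0 else X j ω)) P)
    (hXY : ∀ i, IdentDistrib (X i) Y P P) {c : ℝ} (hc : 0 ≤ c) (r : ℝ) :
    ∫⁻ ω, (∑' i, T i ω) ^ c * ∑' i, T i ω * X i ω ^ r ∂P
      = (∫⁻ ω, Y ω ^ r ∂P) * ∫⁻ ω, (∑' i, T i ω) ^ (c + 1) ∂P := by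
  have hφ (i : ℕ) : Measurable fun t : ℕ → ℝ≥0∞ => (∑' j, t j) ^ c * t i := by fun_prop
  have hφT (i : ℕ) : Measurable fun ω => (∑' j, T j ω) ^ c * T i ω := by fun_prop
  calc ∫⁻ ω, (∑' i, T i ω) ^ c * ∑' i, T i ω * X i ω ^ r ∂P
      = ∑' i, ∫⁻ ω, X i ω ^ r * ((∑' j, T j ω) ^ c * T i ω) ∂P := by
        rw [← lintegral_tsum fun i => by fun_prop]
        refine lintegral_congr fun ω => ?_
        rw [← ENNReal.tsum_mul_left]
        exact tsum_congr fun i => by ring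
    _ = ∑' i, (∫⁻ ω, Y ω ^ r ∂P) * ∫⁻ ω, (∑' j, T j ω) ^ c * T i ω ∂P :=
        tsum_congr fun i => lintegral_rpow_mul_weight hT hX hind hXY (hφ i) r i
    _ = _ := by
        rw [ENNReal.tsum_mul_left, ← lintegral_tsum fun i => (hφT i).aemeasurable]
        congr 1
        refine lintegral_congr fun ω => ?_
        rw [ENNReal.tsum_mul_left, ENNReal.rpow_add_of_nonneg _ _ hc zero_le_one,
          ENNReal.rpow_one]

theorem lintegral_tsum_rpow_weighted (hT : ∀ i, Measurable (T i)) (hX : ∀ i, Measurable (X i))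
    (hind : ∀ i, IndepFun (X i)
      (fun ω => (fun j => T j ω, fun j => if j = i then 0 else X j ω)) P)
    (hXY : ∀ i, IdentDistrib (X i) Y P P) {r : ℝ} (hr : 0 ≤ r) :
    ∫⁻ ω, ∑' i, (T i ω * X i ω) ^ r ∂P
      = (∫⁻ ω, ∑' i, T i ω ^ r ∂P) * ∫⁻ ω, Y ω ^ r ∂P := by
  rw [lintegral_tsum fun i => by fun_prop, lintegral_tsum fun i => by fun_prop,
    mul_comm, ← ENNReal.tsum_mul_left]
  refine tsum_congr fun i => ?_
  rw [← lintegral_rpow_mul_weight hT hX hind hXY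
    (φ := fun t => t i ^ r) ((measurable_pi_apply i).pow_const r) r i]
  refine lintegral_congr fun ω => ?_
  rw [ENNReal.mul_rpow_of_nonneg _ _ hr, mul_comm]

/-- The interaction terms: by independence, the factor `X i ^ r` is replaced by its mean, and then
the sum without the `i`-th summand is bounded by the full one. -/
theorem lintegral_tsum_mul_weightedSum_compl_le
    (hT : ∀ i, Measurable (T i)) (hX : ∀ i, Measurable (X i))
    (hind : ∀ i, IndepFun (X i)
      (fun ω => (fun j => T j ω, fun j => if j = i then 0 else X j ω)) P)
    (hXY : ∀ i, IdentDistrib (X i) Y P P) {r q : ℝ} (hr : 1 ≤ r) (hq : 0 ≤ q) :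
    ∫⁻ ω, ∑' i, (T i ω * X i ω) ^ r * (∑' j, T j ω * if j = i then 0 else X j ω) ^ q ∂P
      ≤ (∫⁻ ω, Y ω ^ r ∂P) * ∫⁻ ω, (∑' i, T i ω) ^ r * (∑' j, T j ω * X j ω) ^ q ∂P := by
  have hX' := measurable_ite_eq_zero hX
  have hm (i : ℕ) : Measurable fun ω =>
      T i ω ^ r * (∑' j, T j ω * if j = i then 0 else X j ω) ^ q := by
    fun_prop
  calc _ = ∑' i, ∫⁻ ω,
        X i ω ^ r * (T i ω ^ r * (∑' j, T j ω * if j = i then 0 else X j ω) ^ q) ∂P := by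
        rw [← lintegral_tsum fun i => by fun_prop]
        refine lintegral_congr fun ω => tsum_congr fun i => ?_
        rw [ENNReal.mul_rpow_of_nonneg _ _ (by linarith)]
        ring
    _ = ∑' i, (∫⁻ ω, Y ω ^ r ∂P)
          * ∫⁻ ω, T i ω ^ r * (∑' j, T j ω * if j = i then 0 else X j ω) ^ q ∂P := by
        refine tsum_congr fun i => ?_
        rw [← lintegral_rpow_eq_of_identDistrib hXY r i]
        exact lintegral_rpow_mul_of_indepFun hT hX (hind i)
          (φ := fun z => z.1 i ^ r * (∑' j, z.1 j * z.2 j) ^ q) (by fun_prop) r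
    _ ≤ _ := by
        rw [ENNReal.tsum_mul_left, ← lintegral_tsum fun i => (hm i).aemeasurable]
        gcongr with ω
        calc _ ≤ ∑' i, T i ω ^ r * (∑' j, T j ω * X j ω) ^ q := by
              gcongr with i j
              split_ifs <;> simp
          _ ≤ _ := by
              rw [ENNReal.tsum_mul_right]
              gcongr
              exact tsum_rpow_le_rpow_tsum hr _

/-- One factor of the power is expanded, and each summand is then separated from the others. -/
theorem weightedSum_rpow_eq {p : ℝ} (hp : 1 ≤ p) (t x : ℕ → ℝ≥0∞) :
    (∑' i, t i * x i) ^ p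
      = ∑' i, t i * x i * (t i * x i + ∑' j, t j * if j = i then 0 else x j) ^ (p - 1) := by
  have h (i : ℕ) : t i * x i + ∑' j, t j * (if j = i then 0 else x j) = ∑' j, t j * x j := by
    rw [ENNReal.tsum_eq_add_tsum_ite (f := fun j => t j * x j) i]
    congr 1
    exact tsum_congr fun j => by split_ifs <;> simp
  simp only [h]
  rw [ENNReal.tsum_mul_right, mul_rpow_sub_one hp]

/-- For `p ≤ 2` the interaction terms are controlled by subadditivity of `x ↦ x ^ (p - 1)`. -/
theorem lintegral_weightedSum_rpow_le_of_le_two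
    (hT : ∀ i, Measurable (T i)) (hX : ∀ i, Measurable (X i))
    (hind : ∀ i, IndepFun (X i)
      (fun ω => (fun j => T j ω, fun j => if j = i then 0 else X j ω)) P)
    (hXY : ∀ i, IdentDistrib (X i) Y P P) (hY : ∫⁻ ω, Y ω ∂P = 1)
    {p : ℝ} (hp : 1 < p) (hp2 : p ≤ 2) :
    ∫⁻ ω, (∑' i, T i ω * X i ω) ^ p ∂P
      ≤ (∫⁻ ω, ∑' i, T i ω ^ p ∂P) * ∫⁻ ω, Y ω ^ p ∂P
        + 2 * ∫⁻ ω, (∑' i, T i ω) ^ p ∂P := by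
  have hTX : Measurable fun ω => ∑' i, (T i ω * X i ω) ^ p := by fun_prop
  calc ∫⁻ ω, (∑' i, T i ω * X i ω) ^ p ∂P
      ≤ ∫⁻ ω, ((∑' i, (T i ω * X i ω) ^ p) + ∑' i, (T i ω * X i ω) ^ (1 : ℝ) *
          (∑' j, T j ω * if j = i then 0 else X j ω) ^ (p - 1)) ∂P := by
        refine lintegral_mono fun ω => ?_
        rw [weightedSum_rpow_eq hp.le (T · ω) (X · ω), ← ENNReal.tsum_add]
        refine ENNReal.tsum_le_tsum fun i => ?_
        rw [← mul_rpow_sub_one hp.le, ENNReal.rpow_one, ← mul_add]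
        gcongr
        exact ENNReal.rpow_add_le_add_rpow _ _ (by linarith) (by linarith)
    _ = (∫⁻ ω, ∑' i, T i ω ^ p ∂P) * ∫⁻ ω, Y ω ^ p ∂P +
          ∫⁻ ω, ∑' i, (T i ω * X i ω) ^ (1 : ℝ) *
          (∑' j, T j ω * if j = i then 0 else X j ω) ^ (p - 1) ∂P := by
        rw [lintegral_add_left hTX,
          lintegral_tsum_rpow_weighted hT hX hind hXY (by linarith)]
    _ ≤ _ := by
        gcongr
        refine (lintegral_tsum_mul_weightedSum_compl_le hT hX hind hXY le_rfl
          (by linarith)).trans ?_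
        simp only [ENNReal.rpow_one, hY, one_mul]
        have e := lintegral_rpow_mul_weightedSum hT hX hind hXY (c := p - 1) (by linarith) 1
        simp only [ENNReal.rpow_one, hY, one_mul, sub_add_cancel] at e
        calc _ ≤ ∫⁻ ω, ((∑' i, T i ω) ^ (p - 1) * (∑' i, T i ω * X i ω)
                + (∑' i, T i ω) ^ p) ∂P := by
              refine lintegral_mono fun ω => ?_
              refine (mul_rpow_le_rpow_mul_add (by linarith) (by linarith) _ _).trans_eq ?_
              rw [mul_add, mul_comm _ (∑' i, T i ω), mul_rpow_sub_one hp.le]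
          _ = _ := by
              rw [lintegral_add_right _ (by fun_prop), e, two_mul]

/-- For `p ≥ 2` the interaction terms only involve the moment of order `p - 1`. -/
theorem lintegral_weightedSum_rpow_le_of_two_le
    (hT : ∀ i, Measurable (T i)) (hX : ∀ i, Measurable (X i))
    (hind : ∀ i, IndepFun (X i)
      (fun ω => (fun j => T j ω, fun j => if j = i then 0 else X j ω)) P)
    (hXY : ∀ i, IdentDistrib (X i) Y P P) (hY : ∫⁻ ω, Y ω ∂P = 1)
    {p : ℝ} (hp : 2 ≤ p) :
    ∫⁻ ω, (∑' i, T i ω * X i ω) ^ p ∂P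
      ≤ (∫⁻ ω, ∑' i, T i ω ^ p ∂P) * ∫⁻ ω, Y ω ^ p ∂P
        + ENNReal.ofReal ((p - 1) * 2 ^ (p - 2)) * 2 * (∫⁻ ω, (∑' i, T i ω) ^ p ∂P)
          * ∫⁻ ω, Y ω ^ (p - 1) ∂P := by
  set C := ENNReal.ofReal ((p - 1) * 2 ^ (p - 2))
  have hTX : Measurable fun ω => ∑' i, (T i ω * X i ω) ^ p := by fun_prop
  have hX' := measurable_ite_eq_zero hX
  have hSm (r q : ℝ) : Measurable fun ω => ∑' i, (T i ω * X i ω) ^ r *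
      (∑' j, T j ω * if j = i then 0 else X j ω) ^ q := by
    fun_prop
  calc ∫⁻ ω, (∑' i, T i ω * X i ω) ^ p ∂P
      ≤ ∫⁻ ω, ((∑' i, (T i ω * X i ω) ^ p) + C * ((∑' i, (T i ω * X i ω) ^ (p - 1) *
          (∑' j, T j ω * if j = i then 0 else X j ω) ^ (1 : ℝ)) +
          (∑' i, (T i ω * X i ω) ^ (1 : ℝ) *
          (∑' j, T j ω * if j = i then 0 else X j ω) ^ (p - 1)))) ∂P := by
        refine lintegral_mono fun ω => ?_
        rw [weightedSum_rpow_eq (by linarith) (T · ω) (X · ω), ← ENNReal.tsum_add,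
          ← ENNReal.tsum_mul_left, ← ENNReal.tsum_add]
        refine ENNReal.tsum_le_tsum fun i => ?_
        refine (mul_le_mul_right (add_rpow_le_rpow_add_mul (by linarith) _ _) _).trans_eq ?_
        rw [mul_add, mul_rpow_sub_one (by linarith), mul_left_comm, mul_add,
          ← mul_assoc (T i ω * X i ω), mul_rpow_sub_one (by linarith), ENNReal.rpow_one,
          ENNReal.rpow_one, show p - 1 - 1 = p - 2 by ring]
    _ = (∫⁻ ω, ∑' i, T i ω ^ p ∂P) * (∫⁻ ω, Y ω ^ p ∂P) +
          C * ((∫⁻ ω, ∑' i, (T i ω * X i ω) ^ (p - 1) *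
          (∑' j, T j ω * if j = i then 0 else X j ω) ^ (1 : ℝ) ∂P) +
          ∫⁻ ω, ∑' i, (T i ω * X i ω) ^ (1 : ℝ) *
          (∑' j, T j ω * if j = i then 0 else X j ω) ^ (p - 1) ∂P) := by
        rw [lintegral_add_left hTX,
          lintegral_tsum_rpow_weighted hT hX hind hXY (by linarith),
          lintegral_const_mul _ (by fun_prop), lintegral_add_left (hSm _ _)]
    _ ≤ (∫⁻ ω, ∑' i, T i ω ^ p ∂P) * (∫⁻ ω, Y ω ^ p ∂P) +
          C * ((∫⁻ ω, Y ω ^ (p - 1) ∂P) * (∫⁻ ω, (∑' i, T i ω) ^ p ∂P) +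
          (∫⁻ ω, Y ω ^ (p - 1) ∂P) * (∫⁻ ω, (∑' i, T i ω) ^ p ∂P)) := by
        gcongr
        · refine (lintegral_tsum_mul_weightedSum_compl_le hT hX hind hXY (by linarith)
            zero_le_one).trans ?_
          have e := lintegral_rpow_mul_weightedSum hT hX hind hXY (c := p - 1) (by linarith) 1
          simp only [ENNReal.rpow_one, hY, one_mul, sub_add_cancel] at e
          simp only [ENNReal.rpow_one, e, le_rfl]
        · refine (lintegral_tsum_mul_weightedSum_compl_le hT hX hind hXY le_rfl
            (by linarith)).trans ?_
          simp only [ENNReal.rpow_one, hY, one_mul]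
          have e := lintegral_rpow_mul_weightedSum hT hX hind hXY (c := p - 1) (by linarith)
            (p - 1)
          rw [sub_add_cancel] at e
          rw [← e]
          refine lintegral_mono fun ω => ?_
          refine (mul_le_mul_right (tsum_mul_rpow_le (by linarith) _ _) _).trans_eq ?_
          rw [← mul_assoc, mul_rpow_sub_one (by linarith)]
    _ = _ := by ring

end WeightedSum

/-! ### The growth of the recursion -/

/-- The bound is `x n ^ β`, where `x (n + 1) = M ^ (1 / β) * x n + C` and `x 0 = 1`. It propagates
because `M * x ^ β + C * x ^ (β - 1) ≤ (M ^ (1 / β) * x + C) ^ β` for `M ≥ 1`. -/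
theorem le_rpow_of_recursion {a : ℕ → ℝ≥0∞} {M C : ℝ≥0} {β : ℝ} (hβ : 1 ≤ β) (hM : 1 ≤ M)
    (h0 : a 0 ≤ 1) (h : ∀ n, a (n + 1) ≤ M * a n + C * a n ^ (1 - 1 / β)) (n : ℕ) :
    a n ≤ ((((M ^ (1 / β)) ^ n + C * ∑ k ∈ Finset.range n, (M ^ (1 / β)) ^ k) ^ β : ℝ≥0)
      : ℝ≥0∞) := by
  have hβ0 : 0 < β := by linarith
  set R : ℝ≥0 := M ^ (1 / β) with hR
  have hRM : R ^ β = M := by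
    rw [hR, ← NNReal.rpow_mul, one_div_mul_cancel hβ0.ne', NNReal.rpow_one]
  have hR1 : 1 ≤ R := NNReal.one_le_rpow hM (by positivity)
  induction n with
  | zero => simpa using h0
  | succ n ih =>
    set x : ℝ≥0 := R ^ n + C * ∑ k ∈ Finset.range n, R ^ k with hx
    have hx' : R ^ (n + 1) + C * ∑ k ∈ Finset.range (n + 1), R ^ k = R * x + C := by
      rw [Finset.sum_range_succ', hx, pow_succ]
      simp only [pow_succ, ← Finset.sum_mul]
      ring
    rw [hx']
    calc a (n + 1) ≤ M * a n + C * a n ^ (1 - 1 / β) := h n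
      _ ≤ M * ((x ^ β : ℝ≥0) : ℝ≥0∞) + C * ((x ^ β : ℝ≥0) : ℝ≥0∞) ^ (1 - 1 / β) := by
          have : 1 / β ≤ 1 := by rw [div_le_one hβ0]; exact hβ
          have : 0 ≤ 1 - 1 / β := by linarith
          gcongr
      _ = ((R ^ β * x ^ β + C * x ^ (β - 1) : ℝ≥0) : ℝ≥0∞) := by
          rw [← ENNReal.coe_rpow_of_nonneg _ (by rw [sub_nonneg, div_le_one hβ0]; exact hβ),
            ← NNReal.rpow_mul, hRM, show β * (1 - 1 / β) = β - 1 by field_simp]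
          push_cast
          rfl
      _ ≤ _ := by
          have split (y : ℝ≥0) : y ^ β = y ^ (β - 1) * y := by
            conv_rhs => rw [← NNReal.rpow_one y, ← NNReal.rpow_mul, one_mul]
            rw [← NNReal.rpow_add_of_nonneg _ (by linarith) zero_le_one]; simp
          rw [ENNReal.coe_le_coe, ← NNReal.mul_rpow, split, split (R * x + C),
            mul_add _ (R * x) C, mul_comm C (x ^ _)]
          have hb : 0 ≤ β - 1 := by linarith
          exact add_le_add
            (mul_le_mul_left (NNReal.rpow_le_rpow le_self_add hb) _)
            (mul_le_mul_left (NNReal.rpow_le_rpow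
              ((le_mul_of_one_le_left' hR1).trans le_self_add) hb) _)

theorem IsFiniteBigO.of_eventually_le {a : ℕ → ℝ≥0∞} {g : ℕ → ℝ} {b : ℕ → ℝ≥0}
    (h : ∀ n, a n ≤ b n) (c : ℝ) (hb : ∀ᶠ n in atTop, (b n : ℝ) ≤ c * g n)
    (hg : ∀ n, 0 ≤ g n) : IsFiniteBigO a g := by
  refine ⟨fun n => (h n).trans_lt ENNReal.coe_lt_top, IsBigO.of_bound c ?_⟩
  filter_upwards [hb] with n hn
  rw [Real.norm_of_nonneg ENNReal.toReal_nonneg, Real.norm_of_nonneg (hg n)]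
  exact (ENNReal.toReal_le_coe_of_le_coe (h n)).trans hn

theorem isFiniteBigO_of_recursion_one {a : ℕ → ℝ≥0∞} {C : ℝ≥0} {β : ℝ} (hβ : 1 ≤ β)
    (h0 : a 0 ≤ 1) (h : ∀ n, a (n + 1) ≤ a n + C * a n ^ (1 - 1 / β)) :
    IsFiniteBigO a (fun n => (n : ℝ) ^ β) := by
  have key := le_rpow_of_recursion hβ le_rfl h0 (M := 1) (C := C) (by simpa using h)
  refine .of_eventually_le key ((1 + C) ^ β) ?_ fun n => by positivity
  filter_upwards [eventually_ge_atTop 1] with n hn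
  have hn' : (1 : ℝ) ≤ n := by exact_mod_cast hn
  rw [NNReal.coe_rpow, ← Real.mul_rpow (by positivity) (by positivity)]
  refine Real.rpow_le_rpow (by positivity) ?_ (by linarith)
  simp only [NNReal.one_rpow, one_pow, Finset.sum_const, Finset.card_range]
  push_cast
  simp
  linarith

theorem isFiniteBigO_of_recursion_one_lt {a : ℕ → ℝ≥0∞} {M C : ℝ≥0} {β : ℝ} (hβ : 1 ≤ β)
    (hM : 1 < M) (h0 : a 0 ≤ 1) (h : ∀ n, a (n + 1) ≤ M * a n + C * a n ^ (1 - 1 / β)) :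
    IsFiniteBigO a (fun n => (M : ℝ) ^ n) := by
  have hβ0 : 0 < β := by linarith
  have key := le_rpow_of_recursion hβ hM.le h0 h
  set R : ℝ≥0 := M ^ (1 / β) with hR
  have hRM : R ^ β = M := by
    rw [hR, ← NNReal.rpow_mul, one_div_mul_cancel hβ0.ne', NNReal.rpow_one]
  have hR1 : (1 : ℝ) < R := by exact_mod_cast NNReal.one_lt_rpow hM (by positivity)
  refine .of_eventually_le key ((1 + C / (R - 1)) ^ β) (.of_forall fun n => ?_)
    fun n => by positivity
  have hd : (0 : ℝ) < R - 1 := by linarith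
  have : ((M : ℝ) ^ n) = ((R : ℝ) ^ n) ^ β := by
    rw [← hRM, NNReal.coe_rpow, ← Real.rpow_natCast, ← Real.rpow_natCast, ← Real.rpow_mul (by simp),
      ← Real.rpow_mul (by simp), mul_comm]
  rw [this, NNReal.coe_rpow, ← Real.mul_rpow (by positivity) (by positivity)]
  refine Real.rpow_le_rpow (by positivity) ?_ (by linarith)
  push_cast
  rw [geom_sum_eq hR1.ne', add_mul, one_mul, div_mul_eq_mul_div, mul_div_assoc]
  gcongr
  linarith

/-! ### The branching property -/

section Branching

variable {Ω : Type*} {L : List ℕ → ℕ → Ω → ℝ≥0}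

/-- The total weight `Zₙ(u)` of the `n`-th generation of the subtree rooted at `u`, where `u`
itself is given the weight one. -/
noncomputable def subtreeZ (L : List ℕ → ℕ → Ω → ℝ≥0) (u : List ℕ) (n : ℕ) (ω : Ω) : ℝ≥0∞ :=
  ∑' w : List.Vector ℕ n, (pathWeight L u w.toList ω : ℝ≥0∞)

theorem tsum_vector_succ (n : ℕ) (f : List ℕ → ℝ≥0∞) :
    ∑' v : List.Vector ℕ (n + 1), f v.toList
      = ∑' i, ∑' w : List.Vector ℕ n, f (i :: w.toList) := by
  let e : ℕ × List.Vector ℕ n ≃ List.Vector ℕ (n + 1) :=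
    { toFun := fun z => z.1 ::ᵥ z.2
      invFun := fun v => (v.head, v.tail)
      left_inv := fun z => by simp
      right_inv := fun v => by simp }
  rw [← e.tsum_eq, ← ENNReal.tsum_prod]
  simp [e]

theorem tsum_vector_zero (f : List ℕ → ℝ≥0∞) :
    ∑' v : List.Vector ℕ 0, f v.toList = f [] := by
  have : Unique (List.Vector ℕ 0) := ⟨⟨.nil⟩, fun v => List.Vector.eq_nil v⟩
  rw [tsum_fintype]
  simp

theorem subtreeZ_zero (u : List ℕ) (ω : Ω) : subtreeZ L u 0 ω = 1 := by
  rw [subtreeZ, tsum_vector_zero fun w => (pathWeight L u w ω : ℝ≥0∞)]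
  simp [pathWeight]

theorem subtreeZ_succ (u : List ℕ) (n : ℕ) (ω : Ω) :
    subtreeZ L u (n + 1) ω = ∑' i, (L u i ω : ℝ≥0∞) * subtreeZ L (u ++ [i]) n ω := by
  rw [subtreeZ, tsum_vector_succ n fun w => (pathWeight L u w ω : ℝ≥0∞)]
  simp [pathWeight, subtreeZ, ENNReal.tsum_mul_left]

theorem subtreeZ_one (u : List ℕ) (ω : Ω) :
    subtreeZ L u 1 ω = ∑' i, (L u i ω : ℝ≥0∞) := by
  simp [subtreeZ_succ, subtreeZ_zero]

theorem measurable_subtreeZ {_ : MeasurableSpace Ω} {u : List ℕ}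
    (h : ∀ w i, Measurable (L (u ++ w) i)) (n : ℕ) : Measurable (subtreeZ L u n) := by
  induction n generalizing u with
  | zero => simpa only [funext (subtreeZ_zero u)] using measurable_const
  | succ n ih =>
    simp only [funext (subtreeZ_succ u n)]
    refine Measurable.tsum fun i => Measurable.mul ?_ (ih fun w j => ?_)
    · simpa using (h [] i).coe_nnreal_ennreal
    · simpa using h ([i] ++ w) j

/-- `Zₙ(u)` is the functional `Zₙ`, evaluated at the field of weights shifted by `u`. -/
theorem subtreeZ_eq_shift (u : List ℕ) (n : ℕ) (ω : Ω) :
    subtreeZ L u n ω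
      = subtreeZ (fun v i (ℓ : List ℕ → ℕ → ℝ≥0) => ℓ v i) [] n (fun v i => L (u ++ v) i ω) := by
  suffices ∀ u' : List ℕ, subtreeZ L (u ++ u') n ω
      = subtreeZ (fun v i (ℓ : List ℕ → ℕ → ℝ≥0) => ℓ v i) u' n (fun v i => L (u ++ v) i ω) by
    simpa using this []
  induction n with
  | zero => simp [subtreeZ_zero]
  | succ n ih => intro u'; simp [subtreeZ_succ, ← ih]

theorem measurable_root_and_subtreeZ_ne {_ : MeasurableSpace Ω} {i : ℕ}
    (h : ∀ v : List ℕ, v.head? ≠ some i → ∀ j, Measurable (L v j)) (n : ℕ) :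
    Measurable fun ω => (fun j => (L [] j ω : ℝ≥0∞),
      fun j => if j = i then 0 else subtreeZ L [j] n ω) := by
  refine Measurable.prodMk (measurable_pi_lambda _ fun j => ?_)
    (measurable_pi_lambda _ fun j => ?_)
  · exact (h [] (by simp) j).coe_nnreal_ennreal
  · by_cases hj : j = i
    · simp [hj]
    · simpa only [hj, if_false] using
        measurable_subtreeZ (fun w k => h _ (by simpa using hj) k) n

variable [MeasurableSpace Ω] {P : Measure Ω}

theorem m_eq (r : ℝ) : m P L r = ∫⁻ ω, ∑' i, (L [] i ω : ℝ≥0∞) ^ r ∂P := by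
  refine lintegral_congr fun ω => ?_
  rw [tsum_vector_succ 0 fun v => (weight L v ω : ℝ≥0∞) ^ r]
  refine tsum_congr fun i => ?_
  rw [tsum_vector_zero fun w => (weight L (i :: w) ω : ℝ≥0∞) ^ r]
  simp [weight, pathWeight]

theorem momentW_eq (hm : m P L 1 = 1) (p : ℝ) (n : ℕ) :
    momentW P L p n = ∫⁻ ω, subtreeZ L [] n ω ^ p ∂P := by
  refine lintegral_congr fun ω => ?_
  rw [W, hm, one_pow, div_one]
  rfl

theorem m_lt_top (hm : m P L 1 = 1) {p : ℝ} (hp : 1 < p) (hW : momentW P L p 1 < ∞) :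
    m P L p < ∞ := by
  refine lt_of_le_of_lt ?_ hW
  rw [m_eq, momentW_eq hm]
  gcongr with ω
  rw [subtreeZ_one]
  exact tsum_rpow_le_rpow_tsum hp.le _

/-- The subtree rooted at the child `i` uses only sequences attached to words that start with `i`,
while the root and the other subtrees use only the remaining ones. -/
theorem IsWeightedBranchingProcess.indepFun_subtreeZ (hL : IsWeightedBranchingProcess P L)
    (n i : ℕ) :
    IndepFun (subtreeZ L [i] n) (fun ω => (fun j => (L [] j ω : ℝ≥0∞),
      fun j => if j = i then 0 else subtreeZ L [j] n ω)) P := by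
  let F (v : List ℕ) : MeasurableSpace Ω :=
    MeasurableSpace.comap (fun ω i => L v i ω) inferInstance
  let S : Set (List ℕ) := {v | v.head? = some i}
  have hle (v : List ℕ) : F v ≤ ‹MeasurableSpace Ω› :=
    (measurable_pi_lambda _ (hL.measurable v)).comap_le
  have hS : Indep (⨆ v ∈ S, F v) (⨆ v ∈ Sᶜ, F v) P :=
    indep_iSup_of_disjoint hle hL.indep.iIndep disjoint_compl_right
  have hLF (A : Set (List ℕ)) (v : List ℕ) (hv : v ∈ A) (j : ℕ) :
      Measurable[⨆ v ∈ A, F v] (L v j) := by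
    refine Measurable.mono ?_ (le_iSup₂_of_le (f := fun v (_ : v ∈ A) => F v) v hv le_rfl) le_rfl
    exact (measurable_pi_apply j).comp (comap_measurable fun ω i => L v i ω)
  rw [IndepFun_iff_Indep]
  refine indep_of_indep_of_le_left (indep_of_indep_of_le_right hS ?_) ?_
  · exact (measurable_root_and_subtreeZ_ne
      (fun v hv => hLF Sᶜ v (by simpa [S] using hv)) n).comap_le
  · exact (measurable_subtreeZ (fun w k => hLF S _ (by simp [S]) k) n).comap_le

variable [IsProbabilityMeasure P]

/-- All subtrees look alike in law: both fields of weights have the same product law. -/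
theorem IsWeightedBranchingProcess.identDistrib_subtreeZ (hL : IsWeightedBranchingProcess P L)
    (u : List ℕ) (n : ℕ) : IdentDistrib (subtreeZ L u n) (subtreeZ L [] n) P P := by
  have hm (v : List ℕ) : Measurable fun ω i => L v i ω :=
    measurable_pi_lambda _ (hL.measurable v)
  have hfield (u : List ℕ) : P.map (fun ω v i => L (u ++ v) i ω)
      = Measure.infinitePi fun _ : List ℕ => P.map fun ω i => L [] i ω := by
    rw [(iIndepFun_iff_map_fun_eq_infinitePi_map (X := fun v ω i => L (u ++ v) i ω)
      fun v => hm (u ++ v)).1 (hL.indep.precomp (List.append_right_injective u))]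
    exact congrArg _ (funext fun v => (hL.identDistrib (u ++ v)).map_eq)
  have hid : IdentDistrib (fun ω v i => L (u ++ v) i ω) (fun ω v i => L ([] ++ v) i ω) P P :=
    ⟨(measurable_pi_lambda _ fun v => hm _).aemeasurable,
      (measurable_pi_lambda _ fun v => hm _).aemeasurable, (hfield u).trans (hfield []).symm⟩
  have hF : Measurable (subtreeZ (fun v i (ℓ : List ℕ → ℕ → ℝ≥0) => ℓ v i) [] n) :=
    measurable_subtreeZ (fun w i => by fun_prop) n
  convert hid.comp hF using 1
  · exact funext fun ω => subtreeZ_eq_shift u n ω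
  · exact funext fun ω => subtreeZ_eq_shift [] n ω

theorem IsWeightedBranchingProcess.lintegral_subtreeZ (hL : IsWeightedBranchingProcess P L)
    (hm : m P L 1 = 1) (n : ℕ) : ∫⁻ ω, subtreeZ L [] n ω ∂P = 1 := by
  induction n with
  | zero => simp [subtreeZ_zero]
  | succ n ih =>
    have h := lintegral_tsum_rpow_weighted (T := fun i ω => (L [] i ω : ℝ≥0∞))
      (X := fun i => subtreeZ L [i] n) (fun i => (hL.measurable [] i).coe_nnreal_ennreal)
      (fun i => measurable_subtreeZ (fun _ _ => hL.measurable _ _) n)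
      (hL.indepFun_subtreeZ n) (fun i => hL.identDistrib_subtreeZ [i] n) zero_le_one
    rw [← m_eq, hm] at h
    simpa [ih, subtreeZ_succ] using h

/-- The recursion `w (n + 1) ≤ m(p) * w n + C * w n ^ θ` for `w n = 𝔼 Wₙᵖ`.
For `p ≤ 2` the exponent `θ = 1 - 1 / max 1 (p - 1)` vanishes. -/
theorem IsWeightedBranchingProcess.momentW_recursion (hL : IsWeightedBranchingProcess P L)
    (hm : m P L 1 = 1) {p : ℝ} (hp : 1 < p) (hW : momentW P L p 1 < ∞) :
    ∃ C : ℝ≥0, ∀ n, momentW P L p (n + 1) ≤ m P L p * momentW P L p n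
      + C * momentW P L p n ^ (1 - 1 / max 1 (p - 1)) := by
  rw [momentW_eq hm] at hW
  simp only [subtreeZ_one] at hW
  have hT (i : ℕ) : Measurable fun ω => (L [] i ω : ℝ≥0∞) :=
    (hL.measurable [] i).coe_nnreal_ennreal
  have hX (n i : ℕ) : Measurable (subtreeZ L [i] n) :=
    measurable_subtreeZ (fun _ _ => hL.measurable _ _) n
  have hid (n i : ℕ) := hL.identDistrib_subtreeZ [i] n
  simp only [momentW_eq hm, subtreeZ_succ, List.nil_append, m_eq]
  rcases le_total p 2 with hp2 | hp2
  · refine ⟨(2 * ∫⁻ ω, (∑' i, (L [] i ω : ℝ≥0∞)) ^ p ∂P).toNNReal, fun n => ?_⟩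
    rw [ENNReal.coe_toNNReal (ENNReal.mul_ne_top (by simp) hW.ne),
      max_eq_left (by linarith)]
    simpa using lintegral_weightedSum_rpow_le_of_le_two hT (hX n) (hL.indepFun_subtreeZ n)
      (hid n) (hL.lintegral_subtreeZ hm n) hp hp2
  · refine ⟨(ENNReal.ofReal ((p - 1) * 2 ^ (p - 2)) * 2 *
      ∫⁻ ω, (∑' i, (L [] i ω : ℝ≥0∞)) ^ p ∂P).toNNReal, fun n => ?_⟩
    rw [ENNReal.coe_toNNReal
      (ENNReal.mul_ne_top (ENNReal.mul_ne_top ENNReal.ofReal_ne_top (by simp)) hW.ne),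
      max_eq_right (by linarith)]
    refine (lintegral_weightedSum_rpow_le_of_two_le hT (hX n) (hL.indepFun_subtreeZ n)
      (hid n) (hL.lintegral_subtreeZ hm n) hp2).trans ?_
    gcongr
    simpa using lintegral_rpow_le_of_lintegral_eq_one
      (measurable_subtreeZ (fun _ _ => hL.measurable _ _) n) (hL.lintegral_subtreeZ hm n)
      (r := p - 1) (by linarith)

end Branching

end WBP

open WBP in
theorem lemma5 {Ω : Type*} [MeasurableSpace Ω] (P : Measure Ω) [IsProbabilityMeasure P]
    (L : List ℕ → ℕ → Ω → ℝ≥0) (hL : WBP.IsWeightedBranchingProcess P L)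
    (hJ : 1 < ∫⁻ ω, WBP.J L ω ∂P) (hm : WBP.m P L 1 = 1)
    (p : ℝ) (hp : 1 < p) (hW : WBP.momentW P L p 1 < ∞) :
    (p ≤ 2 →
      (WBP.m P L p = 1 → WBP.IsFiniteBigO (WBP.momentW P L p) (fun n => (n : ℝ))) ∧
      (1 < WBP.m P L p →
        WBP.IsFiniteBigO (WBP.momentW P L p) (fun n => (WBP.m P L p).toReal ^ n))) ∧
    (2 < p →
      (WBP.m P L p = 1 →
        WBP.IsFiniteBigO (WBP.momentW P L p) (fun n => (n : ℝ) ^ (p - 1))) ∧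
      (1 < WBP.m P L p → ∀ b : ℕ, 1 ≤ b → (b : ℝ) + 1 < p → p ≤ (b : ℝ) + 2 →
        WBP.IsFiniteBigO (WBP.momentW P L p)
          (fun n => (n : ℝ) ^ ((b : ℝ) * (p - 1)) * (WBP.m P L p).toReal ^ n))) := by
  obtain ⟨C, hC⟩ := hL.momentW_recursion hm hp hW
  have h0 : momentW P L p 0 ≤ 1 := by simp [momentW_eq hm, subtreeZ_zero]
  have critical (h : m P L p = 1) :
      IsFiniteBigO (momentW P L p) fun n => (n : ℝ) ^ max 1 (p - 1) :=
    isFiniteBigO_of_recursion_one (le_max_left _ _) h0 (by simpa [h] using hC)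
  have growing (h : 1 < m P L p) :
      IsFiniteBigO (momentW P L p) fun n => (m P L p).toReal ^ n := by
    have e := ENNReal.coe_toNNReal (m_lt_top hm hp hW).ne
    rw [← e] at h hC
    exact isFiniteBigO_of_recursion_one_lt (le_max_left _ _) (by exact_mod_cast h) h0 hC
  refine ⟨fun hp2 => ⟨fun h => ?_, growing⟩, fun hp2 => ⟨fun h => ?_, fun h b _ _ _ => ?_⟩⟩
  · simpa [max_eq_left (show p - 1 ≤ 1 by linarith)] using critical h
  · simpa [max_eq_right (show 1 ≤ p - 1 by linarith)] using critical h
  · -- The polynomial factor is at least one.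
    refine ⟨(growing h).1, (growing h).2.trans (IsBigO.of_bound 1 ?_)⟩
    filter_upwards [eventually_ge_atTop 1] with n hn
    have h1 : (1 : ℝ) ≤ (n : ℝ) ^ ((b : ℝ) * (p - 1)) :=
      Real.one_le_rpow (by exact_mod_cast hn) (mul_nonneg (by simp) (by linarith))
    rw [one_mul, norm_mul]
    exact le_mul_of_one_le_left (norm_nonneg _) (h1.trans (le_abs_self _))
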